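/- Setting. Let $d,p\ge 1$, $T\ge 0$ and an even width $m=2n\ge 2$ be integers, $C,L>0$, and let $\sigma:\mathbb R\to\mathbb R$ be differentiable with $|\sigma'(z)|\le C$ and $|\sigma'(z)-\sigma'(z')|\le C|z-z'|$ for all $z,z'$. For $\theta\in\mathbb R^{d\times m\times p}$ with rows $\theta[i,1],\dots,\theta[i,n],\bar\theta[i,1],\dots,\bar\theta[i,n]\in\mathbb R^p$ ($i=1,\dots,d$) and signs $a_{i,r}\in\{\pm1\}$, let $f(\theta;x)=(f_1(\theta;x),\dots,f_d(\theta;x))\in\mathbb R^d$ be the two-layer network $$f_i(\theta;x)=\frac1{\sqrt m}\Big(\sum_{r=1}^{n}a_{i,r}\,\sigma(\theta[i,r]^\top x)-\sum_{r=1}^{n}a_{i,r}\,\sigma(\bar\theta[i,r]^\top x)\Big).$$ Initialization: the $a_{i,r}$ are uniform on $\{\pm1\}$, the $\theta_1[i,r]$ are $N(0,I_p)$, all of them independent, and $\bar\theta_1[i,r]=\theta_1[i,r]$; the signs stay fixed. Let $x_1,\dots,x_T\in\mathbb R^p$ be unit vectors and $\ell_1,\dots,\ell_T:\mathbb R^d\to\mathbb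 R$ convex and $L$-Lipschitz with respect to the Euclidean norm. For $D>1$ put $R=D\sqrt d$ and $B(R)=\{\theta:\|\theta-\theta_1\|_F\le R\}$. Projected online gradient descent starts at $\theta_1$ and updates $$\theta_{t+1}=\Pi_{B(R)}\big(\theta_t-\eta_t\,\nabla_\theta\,\ell_t(f(\theta;x_t))|_{\theta=\theta_t}\big),\qquad \eta_t=\frac{2R}{CL}\,t^{-1/2},\quad t=1,\dots,T;$$ where the loss is not differentiable, $\nabla_\theta\,\ell_t(f(\theta;x_t))|_{\theta=\theta_t}$ stands for $\mathrm D_\theta f(\theta_t;x_t)^\top s$ with an arbitrary subgradient $s$ of $\ell_t$ at $f(\theta_t;x_t)$. Let $p_0$ be the density of $N(0,I_p)$, let $\mathcal F_{RF}(D)$ be the set of functions $h(x)=\int_{\mathbb R^p}c(w)^\top x\,\sigma'(w^\top x)\,dw$ with $c:\mathbb R^p\to\mathbb R^p$ measurable and $\sup_w\|c(w)\|_2/p_0(w)\le D$, and let $\mathcal F^d_{RF}(D)$ be the set of $g=(g_1,\dots,g_d)$ with all $g_i\in\mathcal F_{RF}(D)$. Theorem. There are universal constants $K>0$ and $k\in\mathbb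 N$ such that in this setting, for all such $d,m,p,T,C,L,\sigma$, all sequences $(x_t)$, $(\ell_t)$ fixed in advance, all $D>1$ and all $\delta>0$, the minimum below is attained and, with probability at least $1-\delta$ over the random initialization, $$\sum_{t=1}^T\ell_t(f(\theta_t;x_t))\le\min_{g\in\mathcal F^d_{RF}(D)}\sum_{t=1}^T\ell_t(g(x_t))+K\,(1+\log d+|\log\delta|)^k\,\frac{L\sqrt{dp}\,CD^2T}{\sqrt m}+K\Big(CLD\sqrt{dT}+\frac{CLD^2dT}{\sqrt m}\Big).$$ -/

import Mathlib

open MeasureTheory ProbabilityTheory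
open scoped InnerProductSpace

namespace OnlineNN

noncomputable section

/-- Parameters `θ ∈ ℝ^{d × m × p}` of the network, with `m = 2 * n` hidden units per output
coordinate. Row `θ i (Sum.inl r)` is `θ[i, r]`, row `θ i (Sum.inr r)` is `θ̄[i, r]`. The norm is the
Frobenius norm. -/
abbrev Param (d n p : ℕ) : Type :=
  PiLp 2 (fun _ : Fin d => PiLp 2 (fun _ : Fin n ⊕ Fin n => EuclideanSpace ℝ (Fin p)))

/-- The two-layer network with activation `σ`, scaling factor `b`, output signs `a i r` on the first
half of the hidden units and `-a i r` on the second half. -/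
def network {d n p : ℕ} (σ : ℝ → ℝ) (b : ℝ) (a : Fin d → Fin n → ℝ)
    (θ : Param d n p) (x : EuclideanSpace ℝ (Fin p)) : EuclideanSpace ℝ (Fin d) :=
  WithLp.toLp 2 fun i =>
    (1 / b) * ((∑ r : Fin n, a i r * σ ⟪θ i (Sum.inl r), x⟫_ℝ) +
      ∑ r : Fin n, (-a i r) * σ ⟪θ i (Sum.inr r), x⟫_ℝ)

/-- The random seed of the initialization: for each output coordinate `i` and each `r`, a coin
(deciding the sign `a i r`) and a vector in `ℝ^p` (the common value of `θ₁[i, r]` and `θ̄₁[i, r]`). -/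
abbrev Seed (d n p : ℕ) : Type :=
  Fin d → Fin n → Bool × EuclideanSpace ℝ (Fin p)

/-- The law of the initialization: all coins are fair, all vectors are `N(0, I_p)`, and everything
is independent. -/
def seedLaw (d n p : ℕ) : Measure (Seed d n p) :=
  Measure.pi fun _ : Fin d => Measure.pi fun _ : Fin n =>
    (PMF.uniformOfFintype Bool).toMeasure.prod (stdGaussian (EuclideanSpace ℝ (Fin p)))

/-- The signs `a i r ∈ {1, -1}` given by the seed. -/
def initSign {d n p : ℕ} (ω : Seed d n p) (i : Fin d) (r : Fin n) : ℝ :=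
  if (ω i r).1 then 1 else -1

/-- The symmetric initial parameters `θ₁`. -/
def initParam {d n p : ℕ} (ω : Seed d n p) : Param d n p :=
  WithLp.toLp 2 fun i => WithLp.toLp 2 (Sum.elim (fun r => (ω i r).2) (fun r => (ω i r).2))

/-- The density of `N(0, I_p)` with respect to Lebesgue measure. -/
def gaussDensity {p : ℕ} (w : EuclideanSpace ℝ (Fin p)) : ℝ :=
  ∏ j : Fin p, gaussianPDFReal 0 1 (w j)

/-- The random-feature class `F_RF(D)`: functions `h(x) = ∫ c(w)ᵀ x σ'(wᵀ x) dw` with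
`sup_w ‖c(w)‖ / p₀(w) ≤ D`. -/
def RFClass {p : ℕ} (σ : ℝ → ℝ) (D : ℝ) : Set (EuclideanSpace ℝ (Fin p) → ℝ) :=
  {h | ∃ c : EuclideanSpace ℝ (Fin p) → EuclideanSpace ℝ (Fin p), Measurable c ∧
    (∀ w, ‖c w‖ / gaussDensity w ≤ D) ∧
    ∀ x, h x = ∫ w, ⟪c w, x⟫_ℝ * deriv σ ⟪w, x⟫_ℝ}

/-- The vector-valued class `F_RF^d(D)`. -/
def RFClassVec {p : ℕ} (d : ℕ) (σ : ℝ → ℝ) (D : ℝ) :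
    Set (EuclideanSpace ℝ (Fin p) → EuclideanSpace ℝ (Fin d)) :=
  {g | ∀ i : Fin d, (fun x => g x i) ∈ RFClass σ D}

/-- `s` is a subgradient of `l` at `y`. -/
def IsSubgradientAt {E : Type*} [NormedAddCommGroup E] [InnerProductSpace ℝ E]
    (l : E → ℝ) (s y : E) : Prop :=
  ∀ z, l y + ⟪s, z - y⟫_ℝ ≤ l z

/-- `v` is a gradient of `θ ↦ l (F θ)` at `θ`, for a convex `l` and a smooth `F`, by the chain rule:
`v = DF(θ)ᵀ s` for a (sub)gradient `s` of `l` at `F θ`. Where `l ∘ F` is differentiable this is the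
ordinary gradient, see `IsCompGradientAt.eq_gradient`. -/
def IsCompGradientAt {E G : Type*} [NormedAddCommGroup E] [InnerProductSpace ℝ E] [CompleteSpace E]
    [NormedAddCommGroup G] [InnerProductSpace ℝ G] [CompleteSpace G]
    (l : G → ℝ) (F : E → G) (v θ : E) : Prop :=
  ∃ s : G, IsSubgradientAt l s (F θ) ∧ v = ContinuousLinearMap.adjoint (fderiv ℝ F θ) s

theorem IsCompGradientAt.eq_gradient {E G : Type*}
    [NormedAddCommGroup E] [InnerProductSpace ℝ E] [CompleteSpace E]
    [NormedAddCommGroup G] [InnerProductSpace ℝ G] [CompleteSpace G]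
    {l : G → ℝ} {F : E → G} {v θ : E} (hv : IsCompGradientAt l F v θ)
    (hF : DifferentiableAt ℝ F θ) (hl : DifferentiableAt ℝ (fun u => l (F u)) θ) :
    v = gradient (fun u => l (F u)) θ := by
  obtain ⟨s, hs, rfl⟩ := hv
  have hd : HasFDerivAt (fun u => l (F u) - innerSL ℝ s (F u))
      (fderiv ℝ (fun u => l (F u)) θ - (innerSL ℝ s).comp (fderiv ℝ F θ)) θ :=
    hl.hasFDerivAt.sub ((innerSL ℝ s).hasFDerivAt.comp θ hF.hasFDerivAt)
  have hmin : IsLocalMin (fun u => l (F u) - innerSL ℝ s (F u)) θ := by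
    refine Filter.Eventually.of_forall fun u => ?_
    have h := hs (F u)
    rw [inner_sub_right] at h
    simp only [innerSL_apply_apply]
    linarith
  have h0 := sub_eq_zero.1 (hmin.hasFDerivAt_eq_zero hd)
  refine ext_inner_right ℝ fun u => ?_
  rw [gradient, InnerProductSpace.toDual_symm_apply, h0, ContinuousLinearMap.adjoint_inner_left]
  simp

/-- `z` is the Euclidean projection of `y` onto the set `K`. -/
def IsProjection {E : Type*} [NormedAddCommGroup E] (K : Set E) (y z : E) : Prop :=
  z ∈ K ∧ ∀ u ∈ K, ‖y - z‖ ≤ ‖y - u‖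

/-- `θ 1, …, θ (T + 1)` are the iterates of projected online gradient descent with step sizes `η t`
and decision set the ball of radius `R` around `θ₁`, started at `θ₁`, where `F t` maps the parameters
to the prediction of round `t`, and `l t` is the loss of round `t` as a function of the prediction. -/
def IsOGDRun {E G : Type*} [NormedAddCommGroup E] [InnerProductSpace ℝ E] [CompleteSpace E]
    [NormedAddCommGroup G] [InnerProductSpace ℝ G] [CompleteSpace G]
    (T : ℕ) (η : ℕ → ℝ) (R : ℝ) (θ₁ : E) (F : ℕ → E → G) (l : ℕ → G → ℝ) (θ : ℕ → E) : Prop :=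
  θ 1 = θ₁ ∧ ∀ t ∈ Finset.Icc 1 T, ∃ v : E, IsCompGradientAt (l t) (F t) v (θ t) ∧
    IsProjection (Metric.closedBall θ₁ R) (θ t - η t • v) (θ (t + 1))

end

end OnlineNN

namespace OnlineNN

/-! The argument splits into a deterministic regret bound, valid for every seed, and one
concentration estimate.

On the ball of radius `R` the linearizations of the network at an iterate and at `θ₁` differ by at
most `3 C R² / √m` (`norm_network_linearization_sub_le`), because `σ'` is Lipschitz. Testing the
subgradient of each loss at the linearized prediction of a comparator `u` reduces regret to the
linear regret of projected gradient descent (`sum_inner_le_of_projected_steps`). The symmetric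
initialization makes the network vanish at `θ₁`, so the comparator predicts `Df(θ₁)(u - θ₁)`
(`IsOGDRun.sum_loss_le`).

A function in the random-feature class is a Gaussian expectation of bounded features. Sampling its
weight function at the initial rows gives a comparator within distance `D √d` of `θ₁` whose linear
prediction is the empirical mean of those features (`comparatorShift`). Hoeffding's lemma controls
the error, and Jensen's inequality over the rounds replaces a union bound, so no `log T` appears
(`measure_lt_sum_norm_le`).

Since inputs and losses are fixed in advance and the minimum is attained
(`exists_isLeast_loss_RFClassVec`), concentration is needed for a single minimizer, not uniformly
over the class. -/

/-! ### Projected online gradient descent -/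

/-- Projecting onto a convex set does not increase the distance to points of that set. -/
theorem IsProjection.norm_sub_le {E : Type*} [NormedAddCommGroup E] [InnerProductSpace ℝ E]
    {K : Set E} (hK : Convex ℝ K) {y z u : E} (h : IsProjection K y z) (hu : u ∈ K) :
    ‖z - u‖ ≤ ‖y - u‖ := by
  have : Nonempty K := ⟨⟨u, hu⟩⟩
  have hmin : ‖y - z‖ = ⨅ w : K, ‖y - w‖ :=
    le_antisymm (le_ciInf fun w => h.2 w w.2)
      (ciInf_le ⟨0, by rintro _ ⟨w, rfl⟩; positivity⟩ (⟨z, h.1⟩ : K))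
  have hin := (norm_eq_iInf_iff_real_inner_le_zero hK h.1).1 hmin u hu
  have h1 : ‖y - u‖ ^ 2 = ‖y - z‖ ^ 2 - 2 * ⟪y - z, u - z⟫_ℝ + ‖u - z‖ ^ 2 := by
    rw [← norm_sub_sq_real]; congr 2; abel
  rw [norm_sub_rev u z] at h1
  have h2 := sq_nonneg ‖y - z‖
  exact abs_le_of_sq_le_sq' (by linarith) (norm_nonneg _) |>.2

/-- Linear regret of projected online gradient descent with step sizes `2 R / G * t ^ (-1/2)`. -/
theorem sum_inner_le_of_projected_steps {E : Type*} [NormedAddCommGroup E]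
    [InnerProductSpace ℝ E] {R G : ℝ} (hR : 0 < R) (hG : 0 < G) (θ v : ℕ → E) (u : E) (T : ℕ)
    (hdist : ∀ t ∈ Finset.Icc 1 (T + 1), ‖θ t - u‖ ≤ 2 * R) (hv : ∀ t ∈ Finset.Icc 1 T, ‖v t‖ ≤ G)
    (hstep : ∀ t ∈ Finset.Icc 1 T,
      ‖θ (t + 1) - u‖ ≤ ‖θ t - (2 * R / G * (t : ℝ) ^ (-(1 / 2) : ℝ)) • v t - u‖) :
    ∑ t ∈ Finset.Icc 1 T, ⟪v t, θ t - u⟫_ℝ ≤ 3 * R * G * √T := by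
  -- The induction keeps the distance to `u` as a potential. Its weight `G √S / (4 R)` is `1 / (2
  -- η)` for the step size `η` of round `S`, so the sum telescopes up to the growth of the weights.
  suffices h : ∀ S ≤ T, ∑ t ∈ Finset.Icc 1 S, ⟪v t, θ t - u⟫_ℝ ≤
      3 * R * G * √S - G / (4 * R) * √S * ‖θ (S + 1) - u‖ ^ 2 by
    refine (h T le_rfl).trans (sub_le_self _ ?_)
    positivity
  intro S
  induction S with
  | zero => simp
  | succ S ih =>
    intro hS
    rw [Finset.sum_Icc_succ_top (by omega)]
    have ih := ih (by omega)
    have hmem : S + 1 ∈ Finset.Icc 1 T := by simp; omega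
    have hA := hdist (S + 1) (by simp; omega)
    have hvS := hv _ hmem
    have hst := hstep _ hmem
    set q : ℝ := √((S + 1 : ℕ) : ℝ) with hq
    set r : ℝ := √(S : ℝ) with hr
    have hqpos : 0 < q := Real.sqrt_pos.2 (by positivity)
    have hq2 : q ^ 2 = S + 1 := by rw [hq, Real.sq_sqrt (by positivity)]; push_cast; rfl
    have hr2 : r ^ 2 = S := Real.sq_sqrt (by positivity)
    have hr0 : 0 ≤ r := Real.sqrt_nonneg _
    have hrq : r ≤ q := Real.sqrt_le_sqrt (by push_cast; linarith)
    have hpow : (((S + 1 : ℕ) : ℝ)) ^ (-(1 / 2) : ℝ) = q⁻¹ := by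
      rw [Real.rpow_neg (by positivity), hq, Real.sqrt_eq_rpow]
    rw [hpow] at hst
    set i : ℝ := ⟪v (S + 1), θ (S + 1) - u⟫_ℝ with hi
    set η : ℝ := 2 * R / G * q⁻¹ with hη
    have hηpos : 0 < η := by positivity
    have hsq : ‖θ (S + 1 + 1) - u‖ ^ 2 ≤
        ‖θ (S + 1) - u‖ ^ 2 - 2 * (η * i) + η ^ 2 * ‖v (S + 1)‖ ^ 2 := by
      calc ‖θ (S + 1 + 1) - u‖ ^ 2 ≤ ‖θ (S + 1) - η • v (S + 1) - u‖ ^ 2 := by gcongr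
        _ = ‖(θ (S + 1) - u) - η • v (S + 1)‖ ^ 2 := by congr 2; abel
        _ = _ := by
          rw [norm_sub_sq_real, real_inner_smul_right, real_inner_comm, norm_smul, mul_pow,
            Real.norm_eq_abs, sq_abs]
    have hv2 : ‖v (S + 1)‖ ^ 2 ≤ G ^ 2 := by gcongr
    have hA2 : ‖θ (S + 1) - u‖ ^ 2 ≤ 4 * R ^ 2 := by
      calc _ ≤ (2 * R) ^ 2 := by gcongr
        _ = _ := by ring
    set A := ‖θ (S + 1) - u‖ ^ 2
    set B := ‖θ (S + 1 + 1) - u‖ ^ 2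
    have hi_le : i ≤ G / (4 * R) * q * (A - B) + R * G * q⁻¹ := by
      have h1 : 2 * (η * i) ≤ A - B + η ^ 2 * G ^ 2 := by nlinarith [sq_nonneg η]
      have h2 : i = G * q / (4 * R) * (2 * (η * i)) := by rw [hη]; field_simp; ring
      have h3 : G * q / (4 * R) * (2 * (η * i)) ≤ G * q / (4 * R) * (A - B + η ^ 2 * G ^ 2) := by
        gcongr
      have h4 : G * q / (4 * R) * (A - B + η ^ 2 * G ^ 2) =
          G / (4 * R) * q * (A - B) + R * G * q⁻¹ := by rw [hη]; field_simp; ring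
      linarith
    -- Discrete form of `∫ t^(-1/2) dt = 2 √t`; it contributes `2 R G √T` of the final `3 R G √T`.
    have hq_inv : 2 * r + q⁻¹ ≤ 2 * q := by
      rw [← sub_nonneg]
      have : 2 * q - (2 * r + q⁻¹) = (q - r) ^ 2 / q := by
        field_simp
        linear_combination hq2 - hr2
      rw [this]; positivity
    -- Growth of the potential's weight, paid for by the diameter `2 R`; it contributes the
    -- remaining `R G √T`.
    have h5 : G / (4 * R) * (q - r) * A ≤ G / (4 * R) * (q - r) * (4 * R ^ 2) := by
      have : 0 ≤ q - r := sub_nonneg.2 hrq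
      gcongr
    have h6 : G / (4 * R) * (q - r) * (4 * R ^ 2) = R * G * (q - r) := by field_simp
    have h7 := mul_le_mul_of_nonneg_left hq_inv (by positivity : 0 ≤ R * G)
    linarith

/-- Moving from `y` in the direction `s` itself raises `l` by at least `‖s‖²` and by at most `L
‖s‖`. -/
theorem IsSubgradientAt.norm_le {E : Type*} [NormedAddCommGroup E] [InnerProductSpace ℝ E]
    {l : E → ℝ} {s y : E} {L : ℝ} (h : IsSubgradientAt l s y) (hL : 0 ≤ L)
    (hl : ∀ y z, |l y - l z| ≤ L * ‖y - z‖) : ‖s‖ ≤ L := by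
  have h1 := h (y + s)
  have h2 := (le_abs_self _).trans (hl (y + s) y)
  simp only [add_sub_cancel_left, real_inner_self_eq_norm_sq] at h1 h2
  nlinarith [norm_nonneg s]

/-! ### Derivative and linearization of the network -/

/-- The output signs of all hidden units. -/
def unitSign {d n : ℕ} (a : Fin d → Fin n → ℝ) (i : Fin d) : Fin n ⊕ Fin n → ℝ :=
  Sum.elim (a i) fun r => -a i r

theorem abs_unitSign {d n : ℕ} {a : Fin d → Fin n → ℝ} (ha : ∀ i r, |a i r| = 1) (i : Fin d)
    (q : Fin n ⊕ Fin n) : |unitSign a i q| = 1 := by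
  cases q <;> simp [unitSign, ha]

theorem network_apply {d n p : ℕ} (σ : ℝ → ℝ) (b : ℝ) (a : Fin d → Fin n → ℝ)
    (θ : Param d n p) (x : EuclideanSpace ℝ (Fin p)) (i : Fin d) :
    network σ b a θ x i = (1 / b) * ∑ q, unitSign a i q * σ ⟪θ i q, x⟫_ℝ := by
  simp [network, unitSign, Fintype.sum_sum_type]

/-- The continuous linear functional `h ↦ ⟪h i q, x⟫` on the parameters. -/
noncomputable def preactivation {d n p : ℕ} (x : EuclideanSpace ℝ (Fin p)) (i : Fin d)
    (q : Fin n ⊕ Fin n) : Param d n p →L[ℝ] ℝ :=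
  innerSL ℝ x ∘L PiLp.proj (𝕜 := ℝ) 2 (fun _ : Fin n ⊕ Fin n => EuclideanSpace ℝ (Fin p)) q
    ∘L PiLp.proj (𝕜 := ℝ) 2 (fun _ : Fin d => PiLp 2 (fun _ : Fin n ⊕ Fin n =>
      EuclideanSpace ℝ (Fin p))) i

theorem preactivation_apply {d n p : ℕ} (x : EuclideanSpace ℝ (Fin p)) (i : Fin d)
    (q : Fin n ⊕ Fin n) (h : Param d n p) : preactivation x i q h = ⟪h i q, x⟫_ℝ := by
  simp [preactivation, real_inner_comm]

theorem hasFDerivAt_network_apply {d n p : ℕ} {σ : ℝ → ℝ} (hσ : Differentiable ℝ σ) (b : ℝ)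
    (a : Fin d → Fin n → ℝ) (θ : Param d n p) (x : EuclideanSpace ℝ (Fin p)) (i : Fin d) :
    HasFDerivAt (fun ϑ : Param d n p => network σ b a ϑ x i)
      ((1 / b) • ∑ q, unitSign a i q • (deriv σ (preactivation x i q θ) • preactivation x i q :
        Param d n p →L[ℝ] ℝ)) θ := by
  simp only [network_apply, ← preactivation_apply]
  exact (HasFDerivAt.fun_sum fun q _ => ((hσ _).hasDerivAt.comp_hasFDerivAt θ
    (preactivation x i q).hasFDerivAt).const_mul _).const_mul _

theorem fderiv_euclidean_apply {E ι : Type*} [NormedAddCommGroup E] [NormedSpace ℝ E] [Fintype ι]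
    {F : E → EuclideanSpace ℝ ι} {A : ι → E →L[ℝ] ℝ} {θ : E}
    (hF : ∀ i, HasFDerivAt (fun ϑ => F ϑ i) (A i) θ) (h : E) (i : ι) :
    fderiv ℝ F θ h i = A i h := by
  have hd : DifferentiableAt ℝ F θ := differentiableAt_euclidean.2 fun i => (hF i).differentiableAt
  have h1 : HasFDerivAt (fun ϑ => F ϑ i)
      (PiLp.proj (𝕜 := ℝ) 2 (fun _ : ι => ℝ) i ∘L fderiv ℝ F θ) θ :=
    (PiLp.proj (𝕜 := ℝ) 2 (fun _ : ι => ℝ) i).hasFDerivAt.comp θ hd.hasFDerivAt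
  rw [← (h1.unique (hF i))]
  rfl

theorem fderiv_network_apply {d n p : ℕ} {σ : ℝ → ℝ} (hσ : Differentiable ℝ σ) (b : ℝ)
    (a : Fin d → Fin n → ℝ) (θ h : Param d n p) (x : EuclideanSpace ℝ (Fin p)) (i : Fin d) :
    fderiv ℝ (fun ϑ : Param d n p => network σ b a ϑ x) θ h i =
      (1 / b) * ∑ q, unitSign a i q * (deriv σ ⟪θ i q, x⟫_ℝ * ⟪h i q, x⟫_ℝ) := by
  rw [fderiv_euclidean_apply (fun i => hasFDerivAt_network_apply hσ b a θ x i),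
    smul_apply, sum_apply, smul_eq_mul]
  simp only [smul_apply, smul_eq_mul, preactivation_apply]

theorem Param.norm_sq_eq {d n p : ℕ} (h : Param d n p) : ‖h‖ ^ 2 = ∑ i, ∑ q, ‖h i q‖ ^ 2 := by
  simp [PiLp.norm_sq_eq_of_L2]

/-- Used where the coordinate errors are quadratic in disjoint blocks of rows: their sum is then a
squared Frobenius norm, and no factor in `d` is lost. -/
theorem EuclideanSpace.norm_le_sum_abs {ι : Type*} [Fintype ι] (y : EuclideanSpace ℝ ι) :
    ‖y‖ ≤ ∑ i, |y i| := by
  refine abs_le_of_sq_le_sq' ?_ (by positivity) |>.2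
  rw [EuclideanSpace.real_norm_sq_eq]
  simp only [← sq_abs (y _)]
  exact Finset.sum_sq_le_sq_sum_of_nonneg fun i _ => abs_nonneg _

/-- Cauchy–Schwarz over the `m` units of one output coordinate cancels the factor `1 / m`. Different
coordinates use disjoint rows, so the squared bounds add up to the Frobenius norm. -/
theorem norm_fderiv_network_le {d n p : ℕ} {σ : ℝ → ℝ} (hσ : Differentiable ℝ σ) {C : ℝ}
    (hC : 0 ≤ C) (hσC : ∀ z, |deriv σ z| ≤ C) {m : ℕ} (hm : 0 < m) (hmn : m = 2 * n)
    {a : Fin d → Fin n → ℝ} (ha : ∀ i r, |a i r| = 1)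
    (θ : Param d n p) {x : EuclideanSpace ℝ (Fin p)} (hx : ‖x‖ = 1) :
    ‖fderiv ℝ (fun ϑ : Param d n p => network σ √m a ϑ x) θ‖ ≤ C := by
  refine ContinuousLinearMap.opNorm_le_bound _ hC fun h => ?_
  refine abs_le_of_sq_le_sq' ?_ (by positivity) |>.2
  rw [EuclideanSpace.real_norm_sq_eq, mul_pow, Param.norm_sq_eq, Finset.mul_sum]
  refine Finset.sum_le_sum fun i _ => ?_
  have hmpos : (0 : ℝ) < m := by exact_mod_cast hm
  rw [fderiv_network_apply hσ, mul_pow, div_pow, Real.sq_sqrt hmpos.le, one_pow]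
  have hcs := sq_sum_le_card_mul_sum_sq (s := Finset.univ)
    (f := fun q => unitSign a i q * (deriv σ ⟪θ i q, x⟫_ℝ * ⟪h i q, x⟫_ℝ))
  have hcard : ((Finset.univ : Finset (Fin n ⊕ Fin n)).card : ℝ) = m := by
    simp [hmn]; ring
  rw [hcard] at hcs
  have hterm : ∀ q, (unitSign a i q * (deriv σ ⟪θ i q, x⟫_ℝ * ⟪h i q, x⟫_ℝ)) ^ 2 ≤
      C ^ 2 * ‖h i q‖ ^ 2 := fun q => by
    rw [← mul_pow, ← sq_abs]
    gcongr
    rw [abs_mul, abs_mul, abs_unitSign ha, one_mul]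
    have := abs_real_inner_le_norm (h i q) x
    rw [hx, mul_one] at this
    exact mul_le_mul (hσC _) this (abs_nonneg _) hC
  calc _ ≤ 1 / (m : ℝ) * (m * ∑ q, C ^ 2 * ‖h i q‖ ^ 2) := by
        gcongr
        exact hcs.trans (by gcongr with q; exact hterm q)
    _ = _ := by field_simp; rw [Finset.mul_sum]

/-- First-order expansions at two points of a function with Lipschitz derivative differ by a
quadratic quantity. -/
theorem abs_linearization_sub_le {σ : ℝ → ℝ} (hσ : Differentiable ℝ σ) {C : ℝ} (hC : 0 ≤ C)
    (hlip : ∀ z z', |deriv σ z - deriv σ z'| ≤ C * |z - z'|) (w u v : ℝ) :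
    |σ u + deriv σ u * (v - u) - (σ w + deriv σ w * (v - w))| ≤
      C * (5 / 2 * (u - w) ^ 2 + 1 / 2 * (v - w) ^ 2) := by
  -- Mean value point between `w` and `u`; the error then involves only differences of `σ'`, to
  -- which the Lipschitz bound applies.
  obtain ⟨ξ, hξ, hξ'⟩ : ∃ ξ, |ξ - w| ≤ |u - w| ∧ σ u - σ w = deriv σ ξ * (u - w) := by
    rcases lt_trichotomy u w with h | rfl | h
    · obtain ⟨ξ, ⟨h1, h2⟩, h3⟩ := exists_deriv_eq_slope σ h hσ.continuous.continuousOn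
        hσ.differentiableOn
      refine ⟨ξ, ?_, ?_⟩
      · rw [abs_of_neg (by linarith), abs_of_neg (by linarith)]; linarith
      · rw [h3]; field_simp [sub_ne_zero.2 h.ne']; ring
    · exact ⟨u, by simp, by simp⟩
    · obtain ⟨ξ, ⟨h1, h2⟩, h3⟩ := exists_deriv_eq_slope σ h hσ.continuous.continuousOn
        hσ.differentiableOn
      refine ⟨ξ, ?_, ?_⟩
      · rw [abs_of_pos (by linarith), abs_of_pos (by linarith)]; linarith
      · rw [h3]; field_simp [sub_ne_zero.2 h.ne']
  have heq : σ u + deriv σ u * (v - u) - (σ w + deriv σ w * (v - w)) =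
      (deriv σ ξ - deriv σ w) * (u - w) + (deriv σ u - deriv σ w) * (v - u) := by
    linear_combination hξ'
  have h1 : |deriv σ ξ - deriv σ w| ≤ C * |u - w| :=
    (hlip _ _).trans (mul_le_mul_of_nonneg_left hξ hC)
  have h2 : |v - u| ≤ |v - w| + |u - w| := by
    rw [abs_sub_comm u w]; exact abs_sub_le v w u
  rw [heq]
  calc _ ≤ |deriv σ ξ - deriv σ w| * |u - w| + |deriv σ u - deriv σ w| * |v - u| := by
        rw [← abs_mul, ← abs_mul]; exact abs_add_le _ _
    _ ≤ C * |u - w| * |u - w| + C * |u - w| * (|v - w| + |u - w|) := by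
        gcongr; exact hlip _ _
    _ = C * (2 * |u - w| ^ 2 + |u - w| * |v - w|) := by ring
    _ ≤ C * (5 / 2 * |u - w| ^ 2 + 1 / 2 * |v - w| ^ 2) := by
        refine mul_le_mul_of_nonneg_left ?_ hC
        nlinarith [sq_nonneg (|u - w| - |v - w|)]
    _ = _ := by rw [sq_abs, sq_abs]

/-- The network and its linearization at `θ₁` are close on the ball of radius `R`. -/
theorem norm_network_linearization_sub_le {d n p : ℕ} {σ : ℝ → ℝ} (hσ : Differentiable ℝ σ) {C : ℝ}
    (hC : 0 ≤ C) (hlip : ∀ z z', |deriv σ z - deriv σ z'| ≤ C * |z - z'|) {b R : ℝ} (hb : 0 ≤ b)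
    {a : Fin d → Fin n → ℝ} (ha : ∀ i r, |a i r| = 1)
    {θ₁ θ θ' : Param d n p} (hθ : ‖θ - θ₁‖ ≤ R) (hθ' : ‖θ' - θ₁‖ ≤ R)
    {x : EuclideanSpace ℝ (Fin p)} (hx : ‖x‖ = 1) :
    ‖network σ b a θ x + fderiv ℝ (fun ϑ => network σ b a ϑ x) θ (θ' - θ) -
      (network σ b a θ₁ x + fderiv ℝ (fun ϑ => network σ b a ϑ x) θ₁ (θ' - θ₁))‖ ≤
      3 * C * R ^ 2 / b := by
  refine (EuclideanSpace.norm_le_sum_abs _).trans ?_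
  have hin : ∀ y : EuclideanSpace ℝ (Fin p), ⟪y, x⟫_ℝ ^ 2 ≤ ‖y‖ ^ 2 := fun y => by
    have := abs_real_inner_le_norm y x
    rw [hx, mul_one] at this
    rw [← sq_abs]; gcongr
  have hcoord : ∀ i, |(network σ b a θ x + fderiv ℝ (fun ϑ => network σ b a ϑ x) θ (θ' - θ) -
      (network σ b a θ₁ x + fderiv ℝ (fun ϑ => network σ b a ϑ x) θ₁ (θ' - θ₁))) i| ≤
      1 / b * ∑ q, C * (5 / 2 * ‖(θ - θ₁) i q‖ ^ 2 + 1 / 2 * ‖(θ' - θ₁) i q‖ ^ 2) := fun i => by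
    simp only [PiLp.sub_apply, PiLp.add_apply, network_apply, fderiv_network_apply hσ]
    rw [← mul_add, ← mul_add, ← mul_sub, abs_mul, abs_of_nonneg (by positivity : 0 ≤ 1 / b),
      ← Finset.sum_add_distrib, ← Finset.sum_add_distrib, ← Finset.sum_sub_distrib]
    gcongr
    refine (Finset.abs_sum_le_sum_abs _ _).trans (Finset.sum_le_sum fun q _ => ?_)
    rw [← mul_add, ← mul_add, ← mul_sub, abs_mul, abs_unitSign ha, one_mul, inner_sub_left,
      inner_sub_left]
    refine (abs_linearization_sub_le hσ hC hlip _ _ _).trans ?_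
    rw [← inner_sub_left, ← inner_sub_left]
    have h1 := hin (θ.ofLp i q - θ₁.ofLp i q)
    have h2 := hin (θ'.ofLp i q - θ₁.ofLp i q)
    refine mul_le_mul_of_nonneg_left ?_ hC
    linarith
  refine (Finset.sum_le_sum fun i _ => hcoord i).trans ?_
  have h1 : ‖θ - θ₁‖ ^ 2 ≤ R ^ 2 := by gcongr
  have h2 : ‖θ' - θ₁‖ ^ 2 ≤ R ^ 2 := by gcongr
  calc _ = C / b * (5 / 2 * ‖θ - θ₁‖ ^ 2 + 1 / 2 * ‖θ' - θ₁‖ ^ 2) := by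
        rw [Param.norm_sq_eq, Param.norm_sq_eq]
        simp only [← Finset.mul_sum, Finset.sum_add_distrib]
        ring
    _ ≤ C / b * (5 / 2 * R ^ 2 + 1 / 2 * R ^ 2) := by gcongr
    _ = _ := by ring

/-- The paired units share their row and carry opposite signs. -/
theorem network_initParam {d n p : ℕ} (σ : ℝ → ℝ) (b : ℝ) (a : Fin d → Fin n → ℝ) (ω : Seed d n p)
    (x : EuclideanSpace ℝ (Fin p)) : network σ b a (initParam ω) x = 0 := by
  ext i
  simp [network, initParam]

theorem abs_initSign {d n p : ℕ} (ω : Seed d n p) (i : Fin d) (r : Fin n) :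
    |initSign ω i r| = 1 := by
  unfold initSign; split_ifs <;> simp

/-! ### Regret against the linearized network -/

/-- Regret of projected online gradient descent against the linearized network. -/
theorem IsOGDRun.sum_loss_le {d m n p T : ℕ} (hm : 0 < m) (hmn : m = 2 * n) {C L R : ℝ}
    (hC : 0 < C) (hL : 0 < L) (hR : 0 < R) {σ : ℝ → ℝ} (hσ : Differentiable ℝ σ)
    (hlip : ∀ z z', |deriv σ z - deriv σ z'| ≤ C * |z - z'|) (hσC : ∀ z, |deriv σ z| ≤ C)
    {x : ℕ → EuclideanSpace ℝ (Fin p)} (hx : ∀ t ∈ Finset.Icc 1 T, ‖x t‖ = 1)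
    {l : ℕ → EuclideanSpace ℝ (Fin d) → ℝ}
    (hl : ∀ t ∈ Finset.Icc 1 T, ∀ y z, |l t y - l t z| ≤ L * ‖y - z‖)
    {ω : Seed d n p} {θ : ℕ → Param d n p}
    (hrun : IsOGDRun T (fun t => 2 * R / (C * L) * (t : ℝ) ^ (-(1 / 2) : ℝ)) R
      (initParam ω) (fun t ϑ => network σ √m (initSign ω) ϑ (x t)) l θ)
    {u : Param d n p} (hu : ‖u - initParam ω‖ ≤ R) :
    ∑ t ∈ Finset.Icc 1 T, l t (network σ √m (initSign ω) (θ t) (x t)) ≤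
      ∑ t ∈ Finset.Icc 1 T, l t (fderiv ℝ (fun ϑ => network σ √m (initSign ω) ϑ (x t))
        (initParam ω) (u - initParam ω)) + 3 * C * L * R * √T + 3 * C * L * R ^ 2 * T / √m := by
  obtain ⟨h1, hstep⟩ := hrun
  -- Outside the rounds `v` is set to `0`, so that the gradients can be chosen as a sequence on all
  -- of `ℕ`.
  have : ∀ t, ∃ v, t ∈ Finset.Icc 1 T →
      IsCompGradientAt (l t) (fun ϑ => network σ √m (initSign ω) ϑ (x t)) v (θ t) ∧
      IsProjection (Metric.closedBall (initParam ω) R)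
        (θ t - (2 * R / (C * L) * (t : ℝ) ^ (-(1 / 2) : ℝ)) • v) (θ (t + 1)) := fun t => by
    by_cases ht : t ∈ Finset.Icc 1 T
    · obtain ⟨v, hv⟩ := hstep t ht
      exact ⟨v, fun _ => hv⟩
    · exact ⟨0, fun h => absurd h ht⟩
  choose v hv using this
  have hball : ∀ t ∈ Finset.Icc 1 (T + 1), ‖θ t - initParam ω‖ ≤ R := fun t ht => by
    simp only [Finset.mem_Icc] at ht
    rcases ht.1.eq_or_lt with rfl | h
    · simp [h1, hR.le]
    · obtain ⟨s, rfl⟩ : ∃ s, t = s + 1 := ⟨t - 1, by omega⟩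
      have := (hv s (by simp; omega)).2.1
      rwa [mem_closedBall_iff_norm] at this
  have hreg := sum_inner_le_of_projected_steps hR (mul_pos hC hL) θ v u T
    (fun t ht => by
      have := norm_sub_le_norm_sub_add_norm_sub (θ t) (initParam ω) u
      have := hball t ht
      rw [norm_sub_rev (initParam ω) u] at *
      linarith)
    (fun t ht => by
      obtain ⟨s, hs, hvs⟩ := (hv t ht).1
      rw [hvs]
      refine (ContinuousLinearMap.le_opNorm _ _).trans ?_
      rw [LinearIsometryEquiv.norm_map]
      exact mul_le_mul (norm_fderiv_network_le hσ hC.le hσC hm hmn (abs_initSign ω) _ (hx t ht))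
        (hs.norm_le hL.le (hl t ht)) (norm_nonneg _) hC.le)
    (fun t ht => (hv t ht).2.norm_sub_le (convex_closedBall _ _)
      (by rwa [mem_closedBall_iff_norm]))
  have hround : ∀ t ∈ Finset.Icc 1 T, l t (network σ √m (initSign ω) (θ t) (x t)) ≤
      l t (fderiv ℝ (fun ϑ => network σ √m (initSign ω) ϑ (x t))
        (initParam ω) (u - initParam ω)) + ⟪v t, θ t - u⟫_ℝ + L * (3 * C * R ^ 2 / √m) :=
      fun t ht => by
    obtain ⟨s, hs, hvs⟩ := (hv t ht).1
    have ht' : t ∈ Finset.Icc 1 (T + 1) := by simp at ht ⊢; omega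
    have hlin := norm_network_linearization_sub_le hσ hC.le hlip (Real.sqrt_nonneg m)
      (abs_initSign ω) (hball t ht') hu (hx t ht)
    rw [network_initParam, zero_add] at hlin
    -- Convexity is used at the linearization around `θ t` evaluated at `u`; the adjoint turns the
    -- subgradient term into `⟪v t, u - θ t⟫`.
    have hsub := hs (network σ √m (initSign ω) (θ t) (x t) +
      fderiv ℝ (fun ϑ => network σ √m (initSign ω) ϑ (x t)) (θ t) (u - θ t))
    rw [add_sub_cancel_left, ← ContinuousLinearMap.adjoint_inner_left, ← hvs] at hsub
    have hlip' := (le_abs_self _).trans (hl t ht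
      (network σ √m (initSign ω) (θ t) (x t) +
        fderiv ℝ (fun ϑ => network σ √m (initSign ω) ϑ (x t)) (θ t) (u - θ t))
      (fderiv ℝ (fun ϑ => network σ √m (initSign ω) ϑ (x t)) (initParam ω) (u - initParam ω)))
    have := mul_le_mul_of_nonneg_left hlin hL.le
    rw [← neg_sub (θ t) u, inner_neg_right] at hsub
    rw [← neg_sub (θ t) u] at *
    linarith
  refine (Finset.sum_le_sum hround).trans ?_
  rw [Finset.sum_add_distrib, Finset.sum_add_distrib, Finset.sum_const, Nat.card_Icc, nsmul_eq_mul]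
  have : ((T + 1 - 1 : ℕ) : ℝ) * (L * (3 * C * R ^ 2 / √m)) = 3 * C * L * R ^ 2 * T / √m := by
    rw [Nat.add_sub_cancel]; ring
  rw [this]
  linarith

/-! ### Minimization over bounded closed convex sets -/

/-- A continuous convex function that is bounded below attains its minimum on a nonempty closed
bounded convex subset of a Hilbert space. -/
theorem exists_isMinOn_of_convexOn {H : Type*} [NormedAddCommGroup H] [InnerProductSpace ℝ H]
    [CompleteSpace H] {A : Set H} (hne : A.Nonempty) (hclosed : IsClosed A) {M : ℝ}
    (hM : ∀ u ∈ A, ‖u‖ ≤ M) {J : H → ℝ} (hJ : ConvexOn ℝ A J) (hcont : Continuous J)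
    (hbdd : BddBelow (J '' A)) : ∃ u ∈ A, IsMinOn J A u := by
  set m := sInf (J '' A) with hm
  -- Nested near-minimal sublevel sets; their points of least norm will converge to a minimizer,
  -- which avoids weak compactness.
  set K : ℕ → Set H := fun k => {u ∈ A | J u ≤ m + 1 / ((k : ℝ) + 1)} with hK
  have hKne : ∀ k, (K k).Nonempty := fun k => by
    obtain ⟨_, ⟨u, hu, rfl⟩, hlt⟩ := exists_lt_of_csInf_lt (hne.image J)
      (lt_add_of_pos_right m (Nat.one_div_pos_of_nat (α := ℝ) (n := k)))
    exact ⟨u, hu, hlt.le⟩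
  have hKclosed : ∀ k, IsClosed (K k) := fun k =>
    hclosed.inter (isClosed_le hcont continuous_const)
  have hKconv : ∀ k, Convex ℝ (K k) := fun k => hJ.convex_le _
  have hanti : ∀ k j, k ≤ j → K j ⊆ K k := fun k j hkj u hu =>
    ⟨hu.1, hu.2.trans (by gcongr)⟩
  have hproj : ∀ k, ∃ w ∈ K k, ∀ u ∈ K k, ‖u - w‖ ^ 2 ≤ ‖u‖ ^ 2 - ‖w‖ ^ 2 := fun k => by
    obtain ⟨w, hw, hmin⟩ := exists_norm_eq_iInf_of_complete_convex (hKne k)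
      (hKclosed k).isComplete (hKconv k) 0
    refine ⟨w, hw, fun u hu => ?_⟩
    have h := (norm_eq_iInf_iff_real_inner_le_zero (hKconv k) hw).1 hmin u hu
    rw [zero_sub, inner_neg_left, inner_sub_right, real_inner_self_eq_norm_sq] at h
    rw [norm_sub_sq_real, real_inner_comm]
    linarith
  choose w hwK hw using hproj
  have hmono : Monotone fun k => ‖w k‖ ^ 2 := fun k j hkj => by
    have := hw k (w j) (hanti k j hkj (hwK j))
    have := sq_nonneg ‖w j - w k‖
    show ‖w k‖ ^ 2 ≤ ‖w j‖ ^ 2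
    linarith
  have hbd : BddAbove (Set.range fun k => ‖w k‖ ^ 2) := by
    refine ⟨M ^ 2, ?_⟩
    rintro _ ⟨k, rfl⟩
    have := hM _ (hwK k).1
    show ‖w k‖ ^ 2 ≤ M ^ 2
    gcongr
  have hcau := (tendsto_atTop_ciSup hmono hbd).cauchySeq
  -- The squared norms increase and are bounded, and by `hw` their increments dominate the squared
  -- distances.
  have hwc : CauchySeq w := by
    rw [Metric.cauchySeq_iff'] at hcau ⊢
    intro ε hε
    obtain ⟨N, hN⟩ := hcau (ε ^ 2) (by positivity)
    refine ⟨N, fun j hj => ?_⟩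
    have h1 := hw N (w j) (hanti N j hj (hwK j))
    have h2 := hN j hj
    rw [Real.dist_eq] at h2
    have h3 := (le_abs_self _).trans_lt h2
    rw [dist_eq_norm]
    exact lt_of_pow_lt_pow_left₀ 2 hε.le (h1.trans_lt h3)
  obtain ⟨u, hu⟩ := cauchySeq_tendsto_of_complete hwc
  have huK : ∀ k, u ∈ K k := fun k => (hKclosed k).mem_of_tendsto hu
    (Filter.eventually_atTop.2 ⟨k, fun j hj => hanti k j hj (hwK j)⟩)
  refine ⟨u, (huK 0).1, fun y hy => ?_⟩
  have h1 : J u ≤ m := by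
    have hlim : Filter.Tendsto (fun k : ℕ => m + 1 / ((k : ℝ) + 1)) Filter.atTop (nhds m) := by
      simpa using (tendsto_one_div_add_atTop_nhds_zero_nat (𝕜 := ℝ)).const_add m
    exact ge_of_tendsto' hlim fun k => (huK k).2
  exact h1.trans (csInf_le hbdd ⟨y, hy, rfl⟩)

/-! ### Random features as Gaussian expectations -/

theorem gaussDensity_pos {p : ℕ} (w : EuclideanSpace ℝ (Fin p)) : 0 < gaussDensity w :=
  Finset.prod_pos fun _ _ => gaussianPDFReal_pos _ _ _ one_ne_zero

theorem measurable_gaussDensity {p : ℕ} :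
    Measurable (gaussDensity : EuclideanSpace ℝ (Fin p) → ℝ) := by
  unfold gaussDensity
  refine Finset.measurable_prod _ fun j _ => (measurable_gaussianPDFReal 0 1).comp ?_
  fun_prop

/-- It suffices to compare the measures on boxes, where the integral of a product density
factorizes. -/
theorem pi_gaussianReal_eq_withDensity (p : ℕ) :
    Measure.pi (fun _ : Fin p => gaussianReal 0 1) =
      (volume : Measure (Fin p → ℝ)).withDensity
        fun w => ENNReal.ofReal (∏ j, gaussianPDFReal 0 1 (w j)) := by
  refine (Measure.pi_eq fun s hs => ?_)
  rw [withDensity_apply _ (MeasurableSet.univ_pi hs), volume_pi, Measure.restrict_pi_pi,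
    ← ofReal_integral_eq_lintegral_ofReal, integral_fintype_prod_eq_prod
      (f := fun _ : Fin p => gaussianPDFReal 0 1), ENNReal.ofReal_prod_of_nonneg]
  · refine Finset.prod_congr rfl fun j _ => ?_
    rw [gaussianReal_apply_eq_integral _ one_ne_zero]
  · exact fun j _ => integral_nonneg fun _ => gaussianPDFReal_nonneg _ _ _
  · exact Integrable.fintype_prod fun j => (integrable_gaussianPDFReal 0 1).restrict
  · exact Filter.Eventually.of_forall fun w =>
      Finset.prod_nonneg fun _ _ => gaussianPDFReal_nonneg _ _ _

theorem stdGaussian_eq_withDensity (p : ℕ) :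
    stdGaussian (EuclideanSpace ℝ (Fin p)) =
      volume.withDensity fun w => ENNReal.ofReal (gaussDensity w) := by
  rw [← map_pi_eq_stdGaussian, pi_gaussianReal_eq_withDensity]
  ext s hs
  have hmp := PiLp.volume_preserving_toLp (Fin p)
  rw [Measure.map_apply hmp.measurable hs,
    withDensity_apply _ (hmp.measurable hs), withDensity_apply _ hs,
    ← hmp.setLIntegral_comp_preimage hs measurable_gaussDensity.ennreal_ofReal]
  rfl

theorem integral_stdGaussian {p : ℕ} (f : EuclideanSpace ℝ (Fin p) → ℝ) :
    ∫ w, f w ∂stdGaussian (EuclideanSpace ℝ (Fin p)) = ∫ w, gaussDensity w * f w := by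
  rw [stdGaussian_eq_withDensity, integral_withDensity_eq_integral_toReal_smul
    measurable_gaussDensity.ennreal_ofReal (by simp)]
  simp [ENNReal.toReal_ofReal (gaussDensity_pos _).le]

/-- The random-feature class in terms of expectations under the standard Gaussian. -/
theorem mem_RFClass_iff {p : ℕ} {σ : ℝ → ℝ} {D : ℝ} {h : EuclideanSpace ℝ (Fin p) → ℝ} :
    h ∈ RFClass σ D ↔ ∃ u : EuclideanSpace ℝ (Fin p) → EuclideanSpace ℝ (Fin p), Measurable u ∧
      (∀ w, ‖u w‖ ≤ D) ∧
      ∀ x, h x = ∫ w, ⟪u w, x⟫_ℝ * deriv σ ⟪w, x⟫_ℝ ∂stdGaussian (EuclideanSpace ℝ (Fin p)) := by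
  constructor
  · rintro ⟨c, hc, hcD, hx⟩
    refine ⟨fun w => (gaussDensity w)⁻¹ • c w, measurable_gaussDensity.inv.smul hc, fun w => ?_,
      fun x => ?_⟩
    · rw [norm_smul, Real.norm_of_nonneg (inv_nonneg.2 (gaussDensity_pos w).le), mul_comm,
        ← div_eq_mul_inv]
      exact hcD w
    · rw [hx, integral_stdGaussian]
      refine integral_congr_ae (Filter.Eventually.of_forall fun w => ?_)
      have := (gaussDensity_pos w).ne'
      simp only [real_inner_smul_left]
      field_simp
  · rintro ⟨u, hu, huD, hx⟩
    refine ⟨fun w => gaussDensity w • u w, measurable_gaussDensity.smul hu, fun w => ?_,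
      fun x => ?_⟩
    · have := gaussDensity_pos w
      rw [norm_smul, Real.norm_of_nonneg this.le, mul_div_cancel_left₀ _ this.ne']
      exact huD w
    · rw [hx, integral_stdGaussian]
      simp only [real_inner_smul_left, mul_assoc]

/-! ### Attainment of the best random-feature loss -/

/-- A set of pointwise almost everywhere bounded functions is closed in `L²`. -/
theorem isClosed_setOf_ae_norm_le {Ω E : Type*} [MeasurableSpace Ω] [NormedAddCommGroup E]
    (μ : Measure Ω) (D : ℝ) : IsClosed {f : Lp E 2 μ | ∀ᵐ w ∂μ, ‖f w‖ ≤ D} := by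
  refine IsSeqClosed.isClosed fun f g hf hg => ?_
  have hm := tendstoInMeasure_of_tendsto_Lp hg
  obtain ⟨ns, -, hns⟩ := hm.exists_seq_tendsto_ae
  filter_upwards [hns, ae_all_iff.2 fun k => hf (ns k)] with w hw hb
  exact le_of_tendsto' hw.norm hb

theorem convex_setOf_ae_norm_le {Ω E : Type*} [MeasurableSpace Ω] [NormedAddCommGroup E]
    [NormedSpace ℝ E] (μ : Measure Ω) (D : ℝ) :
    Convex ℝ {f : Lp E 2 μ | ∀ᵐ w ∂μ, ‖f w‖ ≤ D} := by
  intro f hf g hg a b ha hb hab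
  filter_upwards [hf, hg, Lp.coeFn_add (a • f) (b • g), Lp.coeFn_smul a f, Lp.coeFn_smul b g]
    with w h1 h2 h3 h4 h5
  rw [h3, Pi.add_apply, h4, h5, Pi.smul_apply, Pi.smul_apply]
  have := convex_closedBall (0 : E) D (mem_closedBall_zero_iff.2 h1) (mem_closedBall_zero_iff.2 h2)
    ha hb hab
  exact mem_closedBall_zero_iff.1 this

/-- The random feature `w ↦ σ'(⟪w, x⟫) x` as an element of `L²`. -/
theorem memLp_feature {p : ℕ} {σ : ℝ → ℝ} {C : ℝ} (hσC : ∀ z, |deriv σ z| ≤ C)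
    (x : EuclideanSpace ℝ (Fin p)) :
    MemLp (fun w : EuclideanSpace ℝ (Fin p) => deriv σ ⟪w, x⟫_ℝ • x) 2
      (stdGaussian (EuclideanSpace ℝ (Fin p))) := by
  have hm : Measurable fun w : EuclideanSpace ℝ (Fin p) => deriv σ ⟪w, x⟫_ℝ :=
    (measurable_deriv σ).comp (by fun_prop)
  refine MemLp.of_bound (hm.smul_const x).aestronglyMeasurable (C * ‖x‖)
    (Filter.Eventually.of_forall fun w => ?_)
  rw [norm_smul]
  gcongr
  exact hσC _

/-- Predictions at `x`, depending linearly on the weight functions. -/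
noncomputable def featureMap {p : ℕ} (d : ℕ) {σ : ℝ → ℝ} {C : ℝ} (hσC : ∀ z, |deriv σ z| ≤ C)
    (x : EuclideanSpace ℝ (Fin p)) :
    PiLp 2 (fun _ : Fin d => Lp (EuclideanSpace ℝ (Fin p)) 2
      (stdGaussian (EuclideanSpace ℝ (Fin p)))) →L[ℝ] EuclideanSpace ℝ (Fin d) :=
  (EuclideanSpace.equiv (Fin d) ℝ).symm.toContinuousLinearMap ∘L ContinuousLinearMap.pi fun i =>
    innerSL ℝ (memLp_feature hσC x).toLp ∘L PiLp.proj 2 _ i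

theorem featureMap_apply {p d : ℕ} {σ : ℝ → ℝ} {C : ℝ} (hσC : ∀ z, |deriv σ z| ≤ C)
    (x : EuclideanSpace ℝ (Fin p)) (U : PiLp 2 (fun _ : Fin d => Lp (EuclideanSpace ℝ (Fin p)) 2
      (stdGaussian (EuclideanSpace ℝ (Fin p))))) (i : Fin d)
    {u : EuclideanSpace ℝ (Fin p) → EuclideanSpace ℝ (Fin p)}
    (hu : U i =ᵐ[stdGaussian (EuclideanSpace ℝ (Fin p))] u) :
    featureMap d hσC x U i =
      ∫ w, ⟪u w, x⟫_ℝ * deriv σ ⟪w, x⟫_ℝ ∂stdGaussian (EuclideanSpace ℝ (Fin p)) := by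
  change ⟪(memLp_feature hσC x).toLp, U i⟫_ℝ = _
  rw [L2.inner_def]
  refine integral_congr_ae ?_
  filter_upwards [(memLp_feature hσC x).coeFn_toLp, hu] with w h1 h2
  rw [h1, h2, real_inner_smul_left, real_inner_comm x (u w), mul_comm]

/-- The best cumulative loss in the vector-valued random-feature class is attained. -/
theorem exists_isLeast_loss_RFClassVec {d p T : ℕ} {C L D : ℝ} (hD : 0 ≤ D) {σ : ℝ → ℝ}
    (hσC : ∀ z, |deriv σ z| ≤ C) (x : ℕ → EuclideanSpace ℝ (Fin p))
    {l : ℕ → EuclideanSpace ℝ (Fin d) → ℝ}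
    (hl : ∀ t ∈ Finset.Icc 1 T, ConvexOn ℝ Set.univ (l t) ∧ ∀ y z, |l t y - l t z| ≤ L * ‖y - z‖) :
    ∃ v : ℝ, IsLeast ((fun g : EuclideanSpace ℝ (Fin p) → EuclideanSpace ℝ (Fin d) =>
      ∑ t ∈ Finset.Icc 1 T, l t (g (x t))) '' RFClassVec d σ D) v := by
  set γ := stdGaussian (EuclideanSpace ℝ (Fin p)) with hγ
  -- Weight functions are viewed in `L²` of the Gaussian, where predictions at the inputs are
  -- continuous linear and the constraint `‖u‖ ≤ D` almost everywhere is closed, convex and bounded.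
  let H := PiLp 2 (fun _ : Fin d => Lp (EuclideanSpace ℝ (Fin p)) 2 γ)
  let A : Set H := {U | ∀ i, ∀ᵐ w ∂γ, ‖U i w‖ ≤ D}
  let J : H → ℝ := fun U => ∑ t ∈ Finset.Icc 1 T, l t (featureMap d hσC (x t) U)
  have hAset : A = ⋂ i, (PiLp.proj (𝕜 := ℝ) 2 (fun _ : Fin d => Lp (EuclideanSpace ℝ (Fin p)) 2 γ) i)
      ⁻¹' {f | ∀ᵐ w ∂γ, ‖f w‖ ≤ D} := by
    ext U; simp only [A, Set.mem_iInter, Set.mem_preimage]; rfl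
  have hAclosed : IsClosed A := by
    rw [hAset]
    exact isClosed_iInter fun i => (isClosed_setOf_ae_norm_le γ D).preimage
      (ContinuousLinearMap.continuous _)
  have hAconv : Convex ℝ A := by
    rw [hAset]
    exact convex_iInter fun i => (convex_setOf_ae_norm_le γ D).linear_preimage
      (PiLp.proj (𝕜 := ℝ) 2 (fun _ : Fin d => Lp (EuclideanSpace ℝ (Fin p)) 2 γ) i).toLinearMap
  have hAne : A.Nonempty := ⟨0, fun i => by
    filter_upwards [Lp.coeFn_zero (EuclideanSpace ℝ (Fin p)) 2 γ] with w hw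
    rw [PiLp.zero_apply, hw]; simpa using hD⟩
  have hAbdd : ∀ U ∈ A, ‖U‖ ≤ √(d * D ^ 2) := fun U hU => by
    rw [PiLp.norm_eq_of_L2]
    refine Real.sqrt_le_sqrt ?_
    refine (Finset.sum_le_card_nsmul _ _ (D ^ 2) fun i _ => ?_).trans (by simp)
    have := Lp.norm_le_of_ae_bound hD (hU i)
    have hγ1 : measureUnivNNReal γ = 1 := by simp [measureUnivNNReal]
    rw [hγ1, NNReal.coe_one, Real.one_rpow, one_mul] at this
    gcongr
  have hJcont : Continuous J := continuous_finsetSum _ fun t ht =>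
    (LipschitzWith.of_dist_le' (f := l t) (K := L) fun y z => by
      rw [Real.dist_eq, dist_eq_norm]; exact (hl t ht).2 y z).continuous.comp
      (featureMap d hσC (x t)).continuous
  have hJconv : ConvexOn ℝ A J := by
    refine ⟨hAconv, fun U _ V _ a b ha hb hab => ?_⟩
    simp only [J, smul_eq_mul, Finset.mul_sum, ← Finset.sum_add_distrib]
    refine Finset.sum_le_sum fun t ht => ?_
    rw [map_add, map_smul, map_smul]
    exact (hl t ht).1.2 trivial trivial ha hb hab
  have hJbdd : BddBelow (J '' A) := by
    refine ⟨∑ t ∈ Finset.Icc 1 T, (l t 0 - |L| * (‖featureMap d hσC (x t)‖ * √(d * D ^ 2))), ?_⟩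
    rintro _ ⟨U, hU, rfl⟩
    refine Finset.sum_le_sum fun t ht => ?_
    have h1 := (le_abs_self _).trans ((hl t ht).2 0 (featureMap d hσC (x t) U))
    rw [zero_sub, norm_neg] at h1
    have h2 : L * ‖featureMap d hσC (x t) U‖ ≤
        |L| * (‖featureMap d hσC (x t)‖ * √(d * D ^ 2)) := by
      gcongr
      · exact le_abs_self L
      · exact ((featureMap d hσC (x t)).le_opNorm U).trans (by gcongr; exact hAbdd U hU)
    linarith
  obtain ⟨U, hUA, hU⟩ := exists_isMinOn_of_convexOn hAne hAclosed hAbdd hJconv hJcont hJbdd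
  refine ⟨J U, ?_, ?_⟩
  · have hrep : ∀ i, ∃ u : EuclideanSpace ℝ (Fin p) → EuclideanSpace ℝ (Fin p), Measurable u ∧
        (∀ w, ‖u w‖ ≤ D) ∧ U i =ᵐ[γ] u := fun i => by
      have hmeas := (Lp.stronglyMeasurable (U i)).measurable
      -- The class demands the bound at every point, so the representative is set to `0` on the null
      -- set where it fails.
      refine ⟨fun w => if ‖U i w‖ ≤ D then U i w else 0,
        Measurable.ite (measurableSet_le hmeas.norm measurable_const) hmeas measurable_const,
        fun w => ?_, ?_⟩
      · dsimp only
        split_ifs with h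
        · exact h
        · simpa using hD
      · filter_upwards [hUA i] with w hw
        rw [if_pos hw]
    choose u hum hub hue using hrep
    refine ⟨fun y => WithLp.toLp 2 fun i => ∫ w, ⟪u i w, y⟫_ℝ * deriv σ ⟪w, y⟫_ℝ ∂γ,
      fun i => mem_RFClass_iff.2 ⟨u i, hum i, hub i, fun y => rfl⟩, ?_⟩
    refine Finset.sum_congr rfl fun t _ => congrArg (l t) ?_
    ext i
    rw [featureMap_apply hσC (x t) U i (hue i)]
  · rintro _ ⟨g, hg, rfl⟩
    choose u hum hub hgu using fun i => mem_RFClass_iff.1 (hg i)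
    have hmem : ∀ i, MemLp (u i) 2 γ := fun i =>
      MemLp.of_bound (hum i).aestronglyMeasurable D (Filter.Eventually.of_forall (hub i))
    have hV := hU (a := (WithLp.toLp 2 fun i => (hmem i).toLp : H)) fun i => by
      filter_upwards [(hmem i).coeFn_toLp] with w hw
      rw [hw]
      exact hub i w
    refine hV.trans_eq ?_
    refine Finset.sum_congr rfl fun t _ => congrArg (l t) ?_
    ext i
    rw [featureMap_apply hσC (x t) _ i (hmem i).coeFn_toLp, hgu]

/-! ### Concentration of empirical means -/

instance isProbabilityMeasure_seedLaw (d n p : ℕ) : IsProbabilityMeasure (seedLaw d n p) := by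
  unfold seedLaw; infer_instance

/-- The deviation of the empirical mean of `f` over the units of output coordinate `i`. -/
noncomputable def empiricalError {d n p : ℕ} (f : EuclideanSpace ℝ (Fin p) → ℝ) (i : Fin d)
    (ω : Seed d n p) : ℝ :=
  1 / (n : ℝ) * ∑ r, f (ω i r).2 - ∫ w, f w ∂stdGaussian (EuclideanSpace ℝ (Fin p))

/-- Hoeffding's lemma on `[-B, B]` gives each summand variance proxy `B²`, and independence adds the
proxies. -/
theorem hasSubgaussianMGF_sum_sub_integral {α : Type*} [MeasurableSpace α] {ν : Measure α}
    [IsProbabilityMeasure ν] {f : α → ℝ} (hf : Measurable f) {B : ℝ}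
    (hfB : ∀ w, |f w| ≤ B) (n : ℕ) :
    HasSubgaussianMGF (fun y : Fin n → α => ∑ r, (f (y r) - ∫ w, f w ∂ν))
      (n * ‖B‖₊ ^ 2) (Measure.pi fun _ : Fin n => ν) := by
  have hind : iIndepFun (fun (r : Fin n) (y : Fin n → α) => f (y r) - ∫ w, f w ∂ν)
      (Measure.pi fun _ : Fin n => ν) :=
    iIndepFun_pi (X := fun _ w => f w - ∫ w, f w ∂ν) fun _ => (hf.sub_const _).aemeasurable
  have h1 : HasSubgaussianMGF (fun w => f w - ∫ w, f w ∂ν) (‖B‖₊ ^ 2) ν := by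
    have h := hasSubgaussianMGF_of_mem_Icc (μ := ν) hf.aemeasurable
      (Filter.Eventually.of_forall fun w => abs_le.1 (hfB w))
    have hB : ‖B - -B‖₊ / 2 = ‖B‖₊ := by
      rw [sub_neg_eq_add, ← two_mul, nnnorm_mul]; simp
    rwa [hB] at h
  have h2 := HasSubgaussianMGF.sum_of_iIndepFun hind (s := Finset.univ)
    (c := fun _ => ‖B‖₊ ^ 2) fun r _ => by
      have hmp := measurePreserving_eval (fun _ : Fin n => ν) r
      exact HasSubgaussianMGF.of_map (X := fun w => f w - ∫ w, f w ∂ν) hmp.measurable.aemeasurable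
        (by rw [hmp.map_eq]; exact h1)
  simpa using h2

/-- At the scale `√n / B` the subgaussian exponent is exactly `1 / 2`, and `exp (1 / 2) ≤ 2`. Both
signs are needed to control the absolute value of the error. -/
theorem empiricalError_mgf {d n p : ℕ} (hn : 0 < n) {f : EuclideanSpace ℝ (Fin p) → ℝ}
    (hf : Measurable f) {B : ℝ} (hB : 0 < B) (hfB : ∀ w, |f w| ≤ B) (i : Fin d) {s : ℝ}
    (hs : s ^ 2 = 1) :
    Integrable (fun ω => Real.exp (s * (√n / B) * empiricalError f i ω)) (seedLaw d n p) ∧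
      ∫ ω, Real.exp (s * (√n / B) * empiricalError f i ω) ∂seedLaw d n p ≤ 2 := by
  set ν : Measure (Bool × EuclideanSpace ℝ (Fin p)) :=
    (PMF.uniformOfFintype Bool).toMeasure.prod (stdGaussian (EuclideanSpace ℝ (Fin p)))
  have hsub := hasSubgaussianMGF_sum_sub_integral (ν := ν) (hf.comp measurable_snd)
    (fun w => hfB w.2) n
  have hmp : MeasurePreserving (fun ω : Seed d n p => ω i) (seedLaw d n p)
      (Measure.pi fun _ : Fin n => ν) :=
    measurePreserving_eval (fun _ : Fin d => Measure.pi fun _ : Fin n => ν) i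
  have hsub' := HasSubgaussianMGF.of_map hmp.measurable.aemeasurable (by rw [hmp.map_eq]; exact hsub)
  have hint : ∫ w, (f ∘ Prod.snd) w ∂ν = ∫ w, f w ∂stdGaussian (EuclideanSpace ℝ (Fin p)) := by
    have h : MeasurePreserving Prod.snd ν (stdGaussian (EuclideanSpace ℝ (Fin p))) := measurePreserving_snd
    rw [← h.map_eq, integral_map measurable_snd.aemeasurable hf.aestronglyMeasurable]
    rfl
  have hn' : (0 : ℝ) < n := by exact_mod_cast hn
  have hsq : √(n : ℝ) ^ 2 = n := Real.sq_sqrt hn'.le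
  have hfun : ∀ ω : Seed d n p, s * (√n / B) * empiricalError f i ω =
      s / (√n * B) * (((fun y : Fin n → Bool × EuclideanSpace ℝ (Fin p) =>
        ∑ r, ((f ∘ Prod.snd) (y r) - ∫ w, (f ∘ Prod.snd) w ∂ν)) ∘ fun ω : Seed d n p => ω i) ω) :=
      fun ω => by
    rw [Function.comp_apply, hint, Finset.sum_sub_distrib, empiricalError]
    simp only [Function.comp_apply, Finset.sum_const, Finset.card_univ, Fintype.card_fin,
      nsmul_eq_mul]
    have : 0 < √(n : ℝ) := Real.sqrt_pos.2 hn'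
    field_simp
    rw [hsq]
  simp only [hfun]
  refine ⟨hsub'.integrable_exp_mul _, (hsub'.mgf_le _).trans ?_⟩
  have : (((n * ‖B‖₊ ^ 2 : NNReal) : ℝ)) * (s / (√n * B)) ^ 2 / 2 = 1 / 2 := by
    push_cast
    rw [Real.norm_eq_abs, sq_abs, div_pow, mul_pow, hsq, hs]
    field_simp
  rw [this]
  refine (Real.exp_bound_div_one_sub_of_interval (by norm_num) (by norm_num)).trans ?_
  norm_num

theorem EuclideanSpace.exists_norm_le {ι : Type*} [Fintype ι] [Nonempty ι]
    (y : EuclideanSpace ℝ ι) : ∃ i, ‖y‖ ≤ √(Fintype.card ι) * |y i| := by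
  obtain ⟨i, -, hi⟩ := Finset.exists_max_image Finset.univ (fun i => |y i|) Finset.univ_nonempty
  refine ⟨i, abs_le_of_sq_le_sq' ?_ (by positivity) |>.2⟩
  rw [EuclideanSpace.real_norm_sq_eq, mul_pow, Real.sq_sqrt (by positivity)]
  refine (Finset.sum_le_card_nsmul _ _ (|y i| ^ 2) fun j hj => ?_).trans (by simp)
  rw [← sq_abs]
  have := hi j hj
  gcongr

/-- Tail bound for a sum of norms of random vectors with exponentially integrable coordinates. -/
theorem measure_lt_sum_norm_le {Ω ι τ : Type*} [MeasurableSpace Ω] {P : Measure Ω}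
    [IsProbabilityMeasure P] [Fintype ι] [Nonempty ι] (S : Finset τ) (e : τ → ι → Ω → ℝ)
    {c M s : ℝ} (hc : 0 < c)
    (he : ∀ t ∈ S, ∀ i, ∀ ε : ℝ, ε ^ 2 = 1 → Integrable (fun ω => Real.exp (ε * c * e t i ω)) P ∧
      ∫ ω, Real.exp (ε * c * e t i ω) ∂P ≤ M) :
    P {ω | S.card * √(Fintype.card ι) * s <
        ∑ t ∈ S, ‖(WithLp.toLp 2 fun i => e t i ω : EuclideanSpace ℝ ι)‖} ≤
      ENNReal.ofReal (2 * Fintype.card ι * M * Real.exp (-(c * s))) := by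
  rcases S.eq_empty_or_nonempty with rfl | hS
  · simp
  -- Summing over both signs and all coordinates dominates the exponential of the largest coordinate
  -- in absolute value.
  set W : Ω → ℝ := fun ω => ∑ t ∈ S, ∑ i,
    (Real.exp (1 * c * e t i ω) + Real.exp (-1 * c * e t i ω)) with hW
  have hcard : (0 : ℝ) < S.card := by exact_mod_cast hS.card_pos
  have hι : (0 : ℝ) < Fintype.card ι := by exact_mod_cast Fintype.card_pos
  have hI : ∀ t ∈ S, ∀ i, Integrable
      (fun ω => Real.exp (1 * c * e t i ω) + Real.exp (-1 * c * e t i ω)) P := fun t ht i =>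
    (he t ht i 1 (by norm_num)).1.add (he t ht i (-1) (by norm_num)).1
  have hWint : Integrable W P :=
    integrable_finsetSum _ fun t ht => integrable_finsetSum _ fun i _ => hI t ht i
  have hWle : ∫ ω, W ω ∂P ≤ S.card * (Fintype.card ι * (2 * M)) := by
    rw [hW, integral_finsetSum _ fun t ht => integrable_finsetSum _ fun i _ => hI t ht i]
    refine (Finset.sum_le_card_nsmul _ _ (Fintype.card ι * (2 * M)) fun t ht => ?_).trans_eq
      (nsmul_eq_mul _ _)
    rw [integral_finsetSum _ fun i _ => hI t ht i]
    refine (Finset.sum_le_card_nsmul _ _ (2 * M) fun i _ => ?_).trans_eq (by simp)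
    have h1 := he t ht i 1 (by norm_num)
    have h2 := he t ht i (-1) (by norm_num)
    rw [integral_add h1.1 h2.1]
    linarith [h1.2, h2.2]
  have hsubset : {ω | S.card * √(Fintype.card ι) * s <
        ∑ t ∈ S, ‖(WithLp.toLp 2 fun i => e t i ω : EuclideanSpace ℝ ι)‖} ⊆
      {ω | S.card * Real.exp (c * s) ≤ W ω} := fun ω hω => by
    set y : τ → EuclideanSpace ℝ ι := fun t => WithLp.toLp 2 fun i => e t i ω with hy
    have hω' : S.card * √(Fintype.card ι) * s < ∑ t ∈ S, ‖y t‖ := hω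
    have hsq : 0 < √(Fintype.card ι : ℝ) := Real.sqrt_pos.2 hι
    have hterm : ∀ t, Real.exp (c * (‖y t‖ / √(Fintype.card ι))) ≤
        ∑ i, (Real.exp (1 * c * e t i ω) + Real.exp (-1 * c * e t i ω)) := fun t => by
      obtain ⟨i, hi⟩ := EuclideanSpace.exists_norm_le (y t)
      have hi' : ‖y t‖ / √(Fintype.card ι) ≤ |e t i ω| := by
        rw [div_le_iff₀ hsq, mul_comm]; exact hi
      calc Real.exp (c * (‖y t‖ / √(Fintype.card ι))) ≤ Real.exp (c * |e t i ω|) := by gcongr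
        _ ≤ Real.exp (1 * c * e t i ω) + Real.exp (-1 * c * e t i ω) := by
          rcases abs_cases (e t i ω) with ⟨h, -⟩ | ⟨h, -⟩ <;> rw [h]
          · rw [one_mul]; linarith [Real.exp_pos (-1 * c * e t i ω)]
          · rw [show c * -e t i ω = -1 * c * e t i ω by ring]
            linarith [Real.exp_pos (1 * c * e t i ω)]
        _ ≤ _ := Finset.single_le_sum
          (f := fun i => Real.exp (1 * c * e t i ω) + Real.exp (-1 * c * e t i ω))
          (fun i _ => by positivity) (Finset.mem_univ i)
    -- Jensen for the uniform average over the rounds: a large average error forces a large average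
    -- of exponentials. The factor `S.card` then cancels in Markov's inequality.
    have hjensen := convexOn_exp.map_sum_le (t := S) (w := fun _ => 1 / (S.card : ℝ))
      (p := fun t => c * (‖y t‖ / √(Fintype.card ι))) (fun _ _ => by positivity)
      (by rw [Finset.sum_const, nsmul_eq_mul]; field_simp) (fun _ _ => trivial)
    simp only [smul_eq_mul, ← Finset.mul_sum, ← Finset.sum_div] at hjensen
    have hmean : c * s ≤ 1 / S.card * (c * ((∑ t ∈ S, ‖y t‖) / √(Fintype.card ι))) := by
      rw [show 1 / S.card * (c * ((∑ t ∈ S, ‖y t‖) / √(Fintype.card ι))) =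
        c * ((∑ t ∈ S, ‖y t‖) / (S.card * √(Fintype.card ι))) by field_simp]
      gcongr
      rw [le_div_iff₀ (by positivity)]
      linarith
    have h3 := (Real.exp_le_exp.2 hmean).trans hjensen
    rw [one_div_mul_eq_div, le_div_iff₀ hcard] at h3
    show S.card * Real.exp (c * s) ≤ W ω
    rw [mul_comm]
    exact h3.trans (Finset.sum_le_sum fun t _ => hterm t)
  have hmarkov := mul_meas_ge_le_integral_of_nonneg (μ := P) (f := W)
    (Filter.Eventually.of_forall fun ω => by show 0 ≤ W ω; positivity) hWint
    (S.card * Real.exp (c * s))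
  refine (measure_mono hsubset).trans ?_
  rw [← ofReal_measureReal]
  refine ENNReal.ofReal_le_ofReal ?_
  rw [Real.exp_neg, ← div_eq_mul_inv, le_div_iff₀ (Real.exp_pos _)]
  refine le_of_mul_le_mul_left ?_ hcard
  linarith

/-! ### The comparator near initialization -/

/-- The parameter change that makes the linearized network an empirical average of the weight
functions `u i` over the random features. -/
noncomputable def comparatorShift {d n p : ℕ} (m : ℕ)
    (u : Fin d → EuclideanSpace ℝ (Fin p) → EuclideanSpace ℝ (Fin p)) (ω : Seed d n p) :
    Param d n p :=
  WithLp.toLp 2 fun i => WithLp.toLp 2 fun q =>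
    (1 / √m * unitSign (initSign ω) i q) • u i (ω i (Sum.elim id id q)).2

/-- Each of the `d m` rows has norm at most `D / √m`; this is what the radius `D √d` of the decision
set accommodates. -/
theorem norm_comparatorShift_le {d m n p : ℕ} (hm : 0 < m) (hmn : m = 2 * n) {D : ℝ} (hD : 0 ≤ D)
    {u : Fin d → EuclideanSpace ℝ (Fin p) → EuclideanSpace ℝ (Fin p)} (hu : ∀ i w, ‖u i w‖ ≤ D)
    (ω : Seed d n p) : ‖comparatorShift m u ω‖ ≤ D * √d := by
  refine abs_le_of_sq_le_sq' ?_ (by positivity) |>.2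
  have hmpos : (0 : ℝ) < m := by exact_mod_cast hm
  rw [Param.norm_sq_eq, mul_pow, Real.sq_sqrt (by positivity)]
  have hterm : ∀ i q, ‖comparatorShift m u ω i q‖ ^ 2 ≤ 1 / m * D ^ 2 := fun i q => by
    rw [comparatorShift, norm_smul, mul_pow, Real.norm_eq_abs, abs_mul,
      abs_unitSign (abs_initSign ω), mul_one, sq_abs, div_pow, Real.sq_sqrt hmpos.le, one_pow]
    gcongr
    exact hu _ _
  refine (Finset.sum_le_sum fun i _ => Finset.sum_le_sum fun q _ => hterm i q).trans_eq ?_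
  simp only [Finset.sum_const, Finset.card_univ, Fintype.card_sum, Fintype.card_fin, nsmul_eq_mul]
  have : ((n + n : ℕ) : ℝ) = m := by rw [hmn]; push_cast; ring
  rw [this]
  field_simp

/-- The output signs square to one, so the two copies of each row reinforce each other, and the two
factors `1 / √m` turn the doubled sum into an average over `n`. -/
theorem fderiv_network_comparatorShift {d m n p : ℕ} (hm : 0 < m) (hmn : m = 2 * n) {σ : ℝ → ℝ}
    (hσ : Differentiable ℝ σ) (u : Fin d → EuclideanSpace ℝ (Fin p) → EuclideanSpace ℝ (Fin p))
    (ω : Seed d n p) (x : EuclideanSpace ℝ (Fin p)) (i : Fin d) :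
    fderiv ℝ (fun ϑ => network σ √m (initSign ω) ϑ x) (initParam ω) (comparatorShift m u ω) i =
      1 / (n : ℝ) * ∑ r, ⟪u i (ω i r).2, x⟫_ℝ * deriv σ ⟪(ω i r).2, x⟫_ℝ := by
  have hmpos : (0 : ℝ) < m := by exact_mod_cast hm
  have hnpos : (0 : ℝ) < n := by rw [hmn] at hm; exact_mod_cast (by omega : 0 < n)
  have hterm : ∀ q, unitSign (initSign ω) i q * (deriv σ ⟪initParam ω i q, x⟫_ℝ *
      ⟪comparatorShift m u ω i q, x⟫_ℝ) = 1 / √m * (⟪u i (ω i (Sum.elim id id q)).2, x⟫_ℝ *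
        deriv σ ⟪(ω i (Sum.elim id id q)).2, x⟫_ℝ) := fun q => by
    have h1 : initParam ω i q = (ω i (Sum.elim id id q)).2 := by cases q <;> rfl
    have h2 : unitSign (initSign ω) i q * unitSign (initSign ω) i q = 1 := by
      rw [← abs_mul_abs_self, abs_unitSign (abs_initSign ω), one_mul]
    rw [h1, comparatorShift, real_inner_smul_left]
    linear_combination (1 / √(m : ℝ) * (⟪u i (ω i (Sum.elim id id q)).2, x⟫_ℝ *
        deriv σ ⟪(ω i (Sum.elim id id q)).2, x⟫_ℝ)) * h2
  rw [fderiv_network_apply hσ]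
  simp only [hterm, ← Finset.mul_sum, Fintype.sum_sum_type, Sum.elim_inl, Sum.elim_inr, id]
  rw [← mul_assoc, ← two_mul, ← mul_assoc, div_mul_div_comm, Real.mul_self_sqrt hmpos.le, hmn]
  congr 1
  push_cast
  field_simp

theorem loss_comparatorShift_le {d m n p : ℕ} (hm : 0 < m) (hmn : m = 2 * n) {σ : ℝ → ℝ}
    (hσ : Differentiable ℝ σ) {L : ℝ} {l : EuclideanSpace ℝ (Fin d) → ℝ}
    (hl : ∀ y z, |l y - l z| ≤ L * ‖y - z‖)
    {u : Fin d → EuclideanSpace ℝ (Fin p) → EuclideanSpace ℝ (Fin p)}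
    {y : EuclideanSpace ℝ (Fin d)} {x : EuclideanSpace ℝ (Fin p)}
    (hy : ∀ i, y i = ∫ w, ⟪u i w, x⟫_ℝ * deriv σ ⟪w, x⟫_ℝ ∂stdGaussian (EuclideanSpace ℝ (Fin p)))
    (ω : Seed d n p) :
    l (fderiv ℝ (fun ϑ => network σ √m (initSign ω) ϑ x) (initParam ω) (comparatorShift m u ω)) ≤
      l y + L * ‖(WithLp.toLp 2 fun i =>
        empiricalError (fun w => ⟪u i w, x⟫_ℝ * deriv σ ⟪w, x⟫_ℝ) i ω :
        EuclideanSpace ℝ (Fin d))‖ := by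
  have h := (le_abs_self _).trans (hl (fderiv ℝ (fun ϑ => network σ √m (initSign ω) ϑ x)
    (initParam ω) (comparatorShift m u ω)) y)
  have heq : fderiv ℝ (fun ϑ => network σ √m (initSign ω) ϑ x) (initParam ω)
      (comparatorShift m u ω) - y = WithLp.toLp 2 fun i =>
        empiricalError (fun w => ⟪u i w, x⟫_ℝ * deriv σ ⟪w, x⟫_ℝ) i ω := by
    ext i
    rw [PiLp.sub_apply, fderiv_network_comparatorShift hm hmn hσ, hy]
    rfl
  rw [heq] at h
  linarith

end OnlineNN

/-! ### Assembly of the regret bound -/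

theorem theorem1 :
    ∃ (K : ℝ) (k : ℕ), 0 < K ∧
      ∀ (d m n p T : ℕ), 1 ≤ d → 1 ≤ m → m = 2 * n → 1 ≤ p →
      ∀ (C L : ℝ), 0 < C → 0 < L →
      ∀ (σ : ℝ → ℝ), Differentiable ℝ σ →
        (∀ z z', |deriv σ z - deriv σ z'| ≤ C * |z - z'|) → (∀ z, |deriv σ z| ≤ C) →
      ∀ (x : ℕ → EuclideanSpace ℝ (Fin p)), (∀ t ∈ Finset.Icc 1 T, ‖x t‖ = 1) →
      ∀ (l : ℕ → EuclideanSpace ℝ (Fin d) → ℝ),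
        (∀ t ∈ Finset.Icc 1 T, ConvexOn ℝ Set.univ (l t) ∧
          ∀ y z, |l t y - l t z| ≤ L * ‖y - z‖) →
      ∀ (δ D R : ℝ), 0 < δ → 1 < D → R = D * √d →
      ∃ v : ℝ,
        IsLeast ((fun g : EuclideanSpace ℝ (Fin p) → EuclideanSpace ℝ (Fin d) =>
          ∑ t ∈ Finset.Icc 1 T, l t (g (x t))) '' OnlineNN.RFClassVec d σ D) v ∧
        OnlineNN.seedLaw d n p
          {ω | ¬ ∀ θ : ℕ → OnlineNN.Param d n p,
            OnlineNN.IsOGDRun T (fun t => 2 * R / (C * L) * (t : ℝ) ^ (-(1 / 2) : ℝ)) R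
              (OnlineNN.initParam ω)
              (fun t ϑ => OnlineNN.network σ √m (OnlineNN.initSign ω) ϑ (x t)) l θ →
            ∑ t ∈ Finset.Icc 1 T,
                l t (OnlineNN.network σ √m (OnlineNN.initSign ω) (θ t) (x t)) ≤
              v + K * (1 + Real.log d + |Real.log δ|) ^ k *
                    (L * √(d * p) * C * D ^ 2 * T / √m)
                + K * (C * L * D * √(d * T) + C * L * D ^ 2 * d * T / √m)}
          ≤ ENNReal.ofReal δ := by
  -- The value `3` covers both deterministic error terms and the factor `2 √2` of the random term;
  -- the logarithm enters only to the first power.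
  refine ⟨3, 1, by norm_num, ?_⟩
  intro d m n p T hd hm hmn hp C L hC hL σ hσ hlip hσC x hx l hl δ D R hδ hD hR
  obtain ⟨v, hv⟩ := OnlineNN.exists_isLeast_loss_RFClassVec (T := T) (by linarith : (0 : ℝ) ≤ D)
    hσC x hl
  refine ⟨v, hv, ?_⟩
  obtain ⟨g, hg, hgv⟩ := hv.1
  choose u hum huD hgu using fun i => OnlineNN.mem_RFClass_iff.1 (hg i)
  have hD0 : 0 < D := by linarith
  have hn : 0 < n := by omega
  have hdR : (1 : ℝ) ≤ d := by exact_mod_cast hd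
  have hpR : (1 : ℝ) ≤ p := by exact_mod_cast hp
  have hnR : (0 : ℝ) < n := by exact_mod_cast hn
  have hRpos : 0 < R := by rw [hR]; positivity
  have : Nonempty (Fin d) := ⟨⟨0, hd⟩⟩
  -- Chosen so that the tail bound `4 d exp (-(√n / (C D)) s)` equals `δ`.
  set s : ℝ := C * D / √n * Real.log (4 * d / δ) with hs
  have htail := OnlineNN.measure_lt_sum_norm_le (P := OnlineNN.seedLaw d n p) (Finset.Icc 1 T)
    (fun t i ω => OnlineNN.empiricalError
      (fun w => ⟪u i w, x t⟫_ℝ * deriv σ ⟪w, x t⟫_ℝ) i ω)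
    (c := √n / (C * D)) (M := 2) (s := s) (by positivity) fun t ht i ε hε =>
      OnlineNN.empiricalError_mgf hn (f := fun w => ⟪u i w, x t⟫_ℝ * deriv σ ⟪w, x t⟫_ℝ)
        (((hum i).inner measurable_const).mul ((measurable_deriv σ).comp (by fun_prop)))
        (by positivity) (fun w => by
          rw [abs_mul, mul_comm C D]
          have := abs_real_inner_le_norm (u i w) (x t)
          rw [hx t ht, mul_one] at this
          exact mul_le_mul (this.trans (huD i w)) (hσC _) (abs_nonneg _) hD0.le) i hε
  have hδeq : 2 * (Fintype.card (Fin d) : ℝ) * 2 * Real.exp (-(√n / (C * D) * s)) = δ := by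
    have : √n / (C * D) * s = Real.log (4 * d / δ) := by rw [hs]; field_simp
    rw [this, Real.exp_neg, Real.exp_log (by positivity), Fintype.card_fin]
    field_simp
    norm_num
  rw [hδeq] at htail
  refine (measure_mono fun ω hω => ?_).trans htail
  rw [Set.mem_ofPred_eq] at hω ⊢
  -- Off the tail event the regret bound holds for every run, so the failure event lies inside the
  -- tail event.
  by_contra hsmall
  rw [not_lt] at hsmall
  refine hω fun θ hrun => ?_
  have hreg := hrun.sum_loss_le hm hmn hC hL hRpos hσ hlip hσC hx (fun t ht => (hl t ht).2)
    (u := OnlineNN.initParam ω + OnlineNN.comparatorShift m u ω) (by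
      rw [add_sub_cancel_left, hR]
      exact OnlineNN.norm_comparatorShift_le hm hmn hD0.le huD ω)
  simp only [add_sub_cancel_left] at hreg
  have hcomp := Finset.sum_le_sum fun t (ht : t ∈ Finset.Icc 1 T) =>
    OnlineNN.loss_comparatorShift_le hm hmn hσ (hl t ht).2 (fun i => hgu i (x t)) ω
  rw [Finset.sum_add_distrib, ← Finset.mul_sum] at hcomp
  have hcomp' := hcomp.trans (add_le_add_right (mul_le_mul_of_nonneg_left hsmall hL.le) _)
  have hgv' : ∑ t ∈ Finset.Icc 1 T, l t (g (x t)) = v := hgv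
  rw [hgv', Nat.card_Icc, Nat.add_sub_cancel, Fintype.card_fin] at hcomp'
  have hlog : Real.log (4 * d / δ) ≤ 2 * (1 + Real.log d + |Real.log δ|) := by
    rw [Real.log_div (by positivity) hδ.ne', Real.log_mul (by norm_num) (by positivity),
      show (4 : ℝ) = 2 ^ 2 by norm_num, Real.log_pow]
    have h1 := Real.log_two_lt_d9
    have h2 := Real.log_nonneg hdR
    have h3 := neg_abs_le (Real.log δ)
    have h4 := abs_nonneg (Real.log δ)
    push_cast
    linarith
  have hmain : L * (T * √d * s) ≤ 3 * (1 + Real.log d + |Real.log δ|) ^ 1 *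
      (L * √(d * p) * C * D ^ 2 * T / √m) := by
    have hsm : √(m : ℝ) = √2 * √n := by
      rw [hmn]; push_cast; exact Real.sqrt_mul (by norm_num) _
    have hsqrtn : 0 < √(n : ℝ) := Real.sqrt_pos.2 hnR
    have h2 : 2 * √2 ≤ (3 : ℝ) := by
      nlinarith [Real.sq_sqrt (show (0 : ℝ) ≤ 2 by norm_num), Real.sqrt_nonneg 2]
    have hlogd := Real.log_nonneg hdR
    -- The random term obtained has only `√d` and `D`; passing to `√(d p)` and `D²` uses `p ≥ 1` and
    -- `D > 1`.
    have hsd : √(d : ℝ) ≤ √(d * p) := Real.sqrt_le_sqrt (by nlinarith)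
    have hDD : D ≤ D ^ 2 := by nlinarith
    calc L * (T * √d * s) = L * √d * C * D * T / √n * Real.log (4 * d / δ) := by
          rw [hs]; ring
      _ ≤ L * √d * C * D * T / √n * (2 * (1 + Real.log d + |Real.log δ|)) := by gcongr
      _ ≤ L * √(d * p) * C * D ^ 2 * T / √n * (2 * (1 + Real.log d + |Real.log δ|)) := by gcongr
      _ = (2 * √2) * (1 + Real.log d + |Real.log δ|) ^ 1 *
          (L * √(d * p) * C * D ^ 2 * T / √m) := by rw [hsm]; field_simp
      _ ≤ _ := by gcongr
  have hRT : 3 * C * L * R * √T = 3 * (C * L * D * √(d * T)) := by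
    rw [hR, Real.sqrt_mul (by positivity)]; ring
  have hRm : 3 * C * L * R ^ 2 * T / √m = 3 * (C * L * D ^ 2 * d * T / √m) := by
    rw [hR, mul_pow, Real.sq_sqrt (by positivity)]; ring
  rw [hRT, hRm] at hreg
  linarith
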